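/- **Setting.** Let $(T,\eta,\mu)$ be a finitary monad on $\mathsf{Set}$, let $H\colon\mathsf{Set}\to\mathsf{Set}$ be a finitary functor, and let $H^T\colon \mathsf{Set}^T\to\mathsf{Set}^T$ be a lifting of $H$ to the Eilenberg–Moore category, i.e. $U H^T = H U$ for the forgetful functor $U\colon\mathsf{Set}^T\to\mathsf{Set}$ (more generally, up to a given natural isomorphism $\varphi\colon UH^T\cong HU$, through which we identify the two sides). Here *finitary* means: preserving filtered colimits. **Definitions.** An object $S$ of a category $\mathcal C$ is *finitely generated* (fg) if $\mathcal C(S,-)$ preserves directed colimits of monomorphisms. A coalgebra $(C,c)$ for an endofunctor $G$ of $\mathcal C$ is *locally finitely generated* (lfg) if every morphism $f\colon S\to C$ with $S$ fg factorizes as $f=h\cdot f'$ with $h\colon (P,p)\to (C,c)$ a coalgebra homomorphism, $P$ fg, and $f'\colon S\to P$ a morphism of $\mathcal C$. The *locally finite fixpoint* (LFF) $\vartheta G$ of $G$ is the final object of the full subcategory of lfg $G$-coalgebras; $\nu G$ denotes the final $G$-coalgebra. For $x\colon X\to HTX$, let $x^\sharp\colon (TX,\mu_X)\to H^T(TX,\mu_X)$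 be the unique $T$-algebra homomorphism with $x^\sharp\cdot\eta_X=x$. The assignment $(X,x)\mapsto (TX,x^\sharp)$, $f\mapsto Tf$ is a functor from $HT$-coalgebras to $H^T$-coalgebras (the generalized powerset construction, or determinization). Let $x^{\sharp\ddagger}\colon (TX,x^\sharp)\to\nu H^T$ be the unique $H^T$-coalgebra homomorphism; $x^{\sharp\ddagger}\cdot\eta_X$ is the *coalgebraic language semantics* of $(X,x)$. **Theorem.** The final coalgebra $\nu H^T$ and the locally finite fixpoint $\vartheta H^T$ exist, and the underlying $H$-coalgebra of $\nu H^T$ is a final $H$-coalgebra $\nu H$. The unique $H^T$-coalgebra homomorphism $n\colon\vartheta H^T\to\nu H^T$ is injective, and, identifying $\vartheta H^T$ with its image under $n$, $$\vartheta H^T \;=\; \bigcup_{\substack{x\colon X\to HTX\\ X\text{ finite}}} x^{\sharp\ddagger}[TX] \;=\; \bigcup_{\substack{x\colon X\to HTX\\ X\text{ finite}}} x^{\sharp\ddagger}\cdot\eta_X[X]\;\subseteq\;\nu H^T .$$ Moreover, the diagram in the category of $H$-coalgebras that sends each $HT$-coalgebra $(X,x)$ with $X$ finite to the underlying $H$-coalgebra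 of $(TX,x^\sharp)$ has a colimit $(K,k)$, and $\vartheta H^T$ is the image of the unique $H$-coalgebra homomorphism $k^\ddagger\colon K\to\nu H$: one has $k^\ddagger[K]=\vartheta H^T$ as subsets of $\nu H$, and $k^\ddagger=n\cdot w$ for a surjective $H$-coalgebra homomorphism $w\colon K\to\vartheta H^T$. -/

import Mathlib

open CategoryTheory CategoryTheory.Limits

universe v w u

namespace LFF

section General

variable {C : Type w} [Category.{v} C]

/-- An object `S` is finitely generated if its hom-functor `C(S, -)` preserves directed colimits
of monos, i.e. colimits of (nonempty) directed posets all of whose connecting morphisms are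
monic. -/
def IsFinitelyGenerated (S : C) : Prop :=
  ∀ (J : Type v) [PartialOrder J] [IsDirectedOrder J] [Nonempty J] (F : J ⥤ C),
    (∀ ⦃i j : J⦄ (f : i ⟶ j), Mono (F.map f)) →
      PreservesColimit F (coyoneda.obj (Opposite.op S))

/-- A coalgebra `X` is locally finitely generated (lfg) if every morphism `f : S ⟶ X` from a
finitely generated object factorizes through a coalgebra homomorphism `h : P ⟶ X` where
`P` is a coalgebra with finitely generated carrier. -/
def IsLFG {H : C ⥤ C} : ObjectProperty (Endofunctor.Coalgebra H) := fun X =>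
  ∀ (S : C), IsFinitelyGenerated S → ∀ f : S ⟶ X.V,
    ∃ (P : Endofunctor.Coalgebra H) (h : P ⟶ X) (f' : S ⟶ P.V),
      IsFinitelyGenerated P.V ∧ f' ≫ h.f = f

/-- The full subcategory of locally finitely generated coalgebras. The locally finite fixpoint
of `H` is its terminal object. -/
abbrev CoalgLFG (H : C ⥤ C) := (IsLFG (H := H)).FullSubcategory

theorem comp_aux {X Y TX TY A B HX HY : C} (ηX : X ⟶ TX) (ηY : Y ⟶ TY) (f : X ⟶ Y)
    (Tf : TX ⟶ TY) (sX : TX ⟶ A) (sY : TY ⟶ B) (x : X ⟶ HX) (y : Y ⟶ HY) (i : HX ⟶ A)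
    (j : HY ⟶ B) (Hf : HX ⟶ HY) (m : A ⟶ B) (e1 : ηX ≫ sX = x ≫ i) (e2 : ηY ≫ sY = y ≫ j)
    (h1 : x ≫ Hf = f ≫ y) (h2 : Hf ≫ j = i ≫ m) (h3 : f ≫ ηY = ηX ≫ Tf) :
    ηX ≫ sX ≫ m = ηX ≫ Tf ≫ sY := by
  rw [reassoc_of% e1, ← h2, reassoc_of% h1, ← e2, reassoc_of% h3]

theorem comp_aux' {A B FA FB HA HB : C} (a : A ⟶ FA) (b : B ⟶ FB) (i : FA ⟶ HA) (j : FB ⟶ HB)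
    (f : A ⟶ B) (Ff : FA ⟶ FB) (Hf : HA ⟶ HB) (h1 : a ≫ Ff = f ≫ b) (h2 : Ff ≫ j = i ≫ Hf) :
    (a ≫ i) ≫ Hf = f ≫ b ≫ j := by
  rw [Category.assoc, ← h2, reassoc_of% h1]

end General

section PowersetConstruction

variable {T : Monad (Type u)} {H : Type u ⥤ Type u} {HT : T.Algebra ⥤ T.Algebra}

/-- The extension `f♯ : TX ⟶ A` of a map `f : X ⟶ A` into an Eilenberg-Moore algebra, given by
`a · Tf`; by `eta_sharp` and `hom_ext_eta` it is the unique `T`-algebra homomorphism with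
`η ≫ f♯ = f`. -/
def sharp {X : Type u} {A : T.Algebra} (f : X ⟶ A.A) : T.free.obj X ⟶ A where
  f := T.map f ≫ A.a
  h := by
    change T.map (T.map f ≫ A.a) ≫ A.a = T.μ.app X ≫ T.map f ≫ A.a
    have h1 : T.map (T.map f) ≫ T.μ.app A.A = T.μ.app X ≫ T.map f := T.μ.naturality f
    rw [T.map_comp, Category.assoc, ← A.assoc, reassoc_of% h1]

theorem eta_sharp {X : Type u} {A : T.Algebra} (f : X ⟶ A.A) :
    T.η.app X ≫ (sharp f).f = f := by
  have h1 : f ≫ T.η.app A.A = T.η.app X ≫ T.map f := T.η.naturality f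
  change T.η.app X ≫ T.map f ≫ A.a = f
  rw [← Category.assoc, ← h1, Category.assoc, A.unit]
  exact Category.comp_id f

theorem hom_ext_eta {X : Type u} {A : T.Algebra} {f g : T.free.obj X ⟶ A}
    (h : T.η.app X ≫ f.f = T.η.app X ≫ g.f) : f = g := by
  have key : ∀ k : T.free.obj X ⟶ A, k.f = T.map (T.η.app X ≫ k.f) ≫ A.a := by
    intro k
    have h1 : T.map k.f ≫ A.a = T.μ.app X ≫ k.f := k.h
    have h2 : T.map (T.η.app X) ≫ T.μ.app X = 𝟙 (T.obj X) := T.right_unit X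
    have h3 : T.map (T.η.app X ≫ k.f) = T.map (T.η.app X) ≫ T.map k.f :=
      T.map_comp (T.η.app X) k.f
    rw [h3]
    refine Eq.symm ((Category.assoc _ _ _).trans ((congrArg (T.map (T.η.app X) ≫ ·) h1).trans ?_))
    exact ((Category.assoc _ _ _).symm.trans (congrArg (· ≫ k.f) h2)).trans (Category.id_comp k.f)
  apply Monad.Algebra.Hom.ext
  rw [key f, key g, h]

/-- For an `HT`-coalgebra `x : X ⟶ H(TX)`, the `T`-algebra homomorphism
`x♯ : (TX, μ) ⟶ H^T(TX, μ)`; here `H(TX)` is the carrier of `H^T(TX, μ)` via `φ`. -/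
def coalgSharp (φ : HT ⋙ T.forget ≅ T.forget ⋙ H)
    (X : Endofunctor.Coalgebra (T.toFunctor ⋙ H)) :
    T.free.obj X.V ⟶ HT.obj (T.free.obj X.V) :=
  sharp (X.str ≫ φ.inv.app (T.free.obj X.V))

/-- The generalized powerset construction, as a functor: `(X, x) ↦ (TX, x♯)`, `f ↦ Tf`. -/
def determinize (φ : HT ⋙ T.forget ≅ T.forget ⋙ H) :
    Endofunctor.Coalgebra (T.toFunctor ⋙ H) ⥤ Endofunctor.Coalgebra HT where
  obj X := { V := T.free.obj X.V, str := coalgSharp φ X }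
  map {X Y} f :=
    { f := T.free.map f.f
      h := by
        apply hom_ext_eta
        exact comp_aux (T.η.app X.V) (T.η.app Y.V) f.f (T.map f.f) (coalgSharp φ X).f
          (coalgSharp φ Y).f X.str Y.str (φ.inv.app (T.free.obj X.V))
          (φ.inv.app (T.free.obj Y.V)) (H.map (T.map f.f)) (HT.map (T.free.map f.f)).f
          (eta_sharp _) (eta_sharp _) f.h (φ.inv.naturality (T.free.map f.f))
          (T.η.naturality f.f) }
  map_id X := by
    apply Endofunctor.Coalgebra.Hom.ext
    exact T.free.map_id X.V
  map_comp f g := by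
    apply Endofunctor.Coalgebra.Hom.ext
    exact T.free.map_comp f.f g.f

/-- The forgetful functor `Coalg H^T ⥤ Coalg H`. -/
def forgetCoalg (φ : HT ⋙ T.forget ≅ T.forget ⋙ H) :
    Endofunctor.Coalgebra HT ⥤ Endofunctor.Coalgebra H where
  obj A := { V := A.V.A, str := A.str.f ≫ φ.hom.app A.V }
  map {A B} f :=
    { f := f.f.f
      h := by
        exact comp_aux' A.str.f B.str.f (φ.hom.app A.V) (φ.hom.app B.V) f.f.f
          (HT.map f.f).f (H.map f.f.f) (congrArg Monad.Algebra.Hom.f f.h)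
          (φ.hom.naturality f.f) }
  map_id A := rfl
  map_comp f g := rfl

/-- The full subcategory of coalgebras with finite carrier (the finitely generated objects of
`Type u` are the finite sets). -/
abbrev FinCoalg (G : Type u ⥤ Type u) :=
  ObjectProperty.FullSubcategory (fun X : Endofunctor.Coalgebra G => Finite X.V)

/-- The diagram of all determinized finite `HT`-coalgebras, as `H`-coalgebras. -/
def finDeterminized (φ : HT ⋙ T.forget ≅ T.forget ⋙ H) :
    FinCoalg (T.toFunctor ⋙ H) ⥤ Endofunctor.Coalgebra H :=
  ObjectProperty.ι _ ⋙ determinize φ ⋙ forgetCoalg φ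

/-- The map `x♯‡ : TX ⟶ νH^T`, underlying the unique `H^T`-coalgebra homomorphism from
`(TX, x♯)` into the final coalgebra `N`. -/
def sharpFinal (φ : HT ⋙ T.forget ≅ T.forget ⋙ H) {N : Endofunctor.Coalgebra HT}
    (hN : IsTerminal N) (X : Endofunctor.Coalgebra (T.toFunctor ⋙ H)) :
    T.obj X.V ⟶ N.V.A :=
  (hN.from ((determinize φ).obj X)).f.f

/-- The coalgebraic language semantics `x♯‡ · η : X ⟶ νH^T` of an `HT`-coalgebra. -/
def languageSemantics (φ : HT ⋙ T.forget ≅ T.forget ⋙ H) {N : Endofunctor.Coalgebra HT}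
    (hN : IsTerminal N) (X : Endofunctor.Coalgebra (T.toFunctor ⋙ H)) :
    X.V ⟶ N.V.A :=
  T.η.app X.V ≫ sharpFinal φ hN X

end PowersetConstruction

end LFF

/-! Since `H` is finitary, each element of `H X` comes from a finite subset of `X`. So `H` is a
quotient of a polynomial functor, and `νH` exists. Determinizing along the unit of `T` (`freeCoalg`)
is left adjoint to forgetting from `H^T`-coalgebras to `H`-coalgebras. Hence every final
`H^T`-coalgebra is final over `H`; conversely, finality endows `νH` with a `T`-algebra structure
that makes it final over `H^T` (`isTerminalFinalCoalg`).

The locally finite fixpoint is built inside `νH^T` as the set `finiteBehaviours` of all values of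
maps out of determinized finite coalgebras. Finitely many such values always lie in the image of a
single finite coalgebra, a coproduct. As `T` is finitary, the set is therefore a subalgebra, and it
is a union of subcoalgebras. Finitely generated algebras are exactly the quotients of some `TY` with
`Y` finite, so a map from one of them into this set lands in one finitely generated image: the set
is lfg. Conversely, if `TY` maps onto an fg-carried coalgebra, its structure on generators lifts
through `H` of that surjection, giving a finite `HT`-coalgebra with the same behaviours
(`IsLFG.mem_finiteBehaviours`). So every lfg coalgebra factorizes through the set, uniquely because
the inclusion is injective.

Restricting to generators loses nothing, because any `t` in `TX` can be adjoined to `X` as a new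
state (`exists_generator`). The colimit `K` maps onto the fixpoint because the determinized finite
coalgebras jointly cover it. -/

namespace LFF

/-! ### Finitary set functors and their final coalgebras -/

section SetFunctors

variable (G : Type u ⥤ Type u)

theorem map_map_apply {X Y Z : Type u} (f : X ⟶ Y) (g : Y ⟶ Z) (t : G.obj X) :
    G.map g (G.map f t) = G.map (f ≫ g) t := by
  rw [G.map_comp]; rfl

theorem map_congr {X Y : Type u} {f g : X ⟶ Y} (h : ∀ x, f x = g x) (t : G.obj X) :
    G.map f t = G.map g t := by
  have : f = g := by ext x; exact h x
  rw [this]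

theorem map_surjective {X Y : Type u} {f : X ⟶ Y} (hf : Function.Surjective f) :
    Function.Surjective (G.map f) := by
  intro t
  refine ⟨G.map (↾(Function.surjInv hf)) t, ?_⟩
  have h : (↾(Function.surjInv hf)) ≫ f = 𝟙 Y := by
    ext y
    exact Function.surjInv_eq hf y
  rw [map_map_apply, h, G.map_id]
  rfl

/-- An injection with nonempty domain splits, and functors preserve split monos. For an empty domain
this can fail, which is why nonemptiness is checked wherever injectivity is transported below. -/
theorem map_injective {X Y : Type u} [Nonempty X] {f : X ⟶ Y} (hf : Function.Injective f) :
    Function.Injective (G.map f) := by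
  have h : f ≫ (↾(Function.invFun f)) = 𝟙 X := by
    ext x
    exact Function.leftInverse_invFun hf x
  intro s t hst
  have := congrArg (G.map (↾(Function.invFun f))) hst
  rw [map_map_apply, map_map_apply, h, G.map_id] at this
  exact this

/-- Directed unions are colimits in `Type u`. -/
noncomputable def isColimitOfDirectedUnion {J : Type u} [PartialOrder J] [IsDirectedOrder J]
    [Nonempty J] {F : J ⥤ Type u} (c : Cocone F)
    (hsurj : ∀ x : c.pt, ∃ i y, c.ι.app i y = x)
    (hinj : ∀ i, Function.Injective (c.ι.app i)) : IsColimit c :=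
  Types.FilteredColimit.isColimitOf' F c
    (fun x => let ⟨i, y, h⟩ := hsurj x; ⟨i, y, h.symm⟩)
    (fun i _ _ h => ⟨i, 𝟙 i, congrArg _ (hinj i h)⟩)

/-- The diagram of finite subsets of a set. -/
def finsetDiagram (X : Type u) : Finset X ⥤ Type u where
  obj s := {x // x ∈ s}
  map f := ↾(fun x => ⟨x.1, leOfHom f x.2⟩)

/-- Every set is the directed union of its finite subsets. -/
def finsetCocone (X : Type u) : Cocone (finsetDiagram X) where
  pt := X
  ι := { app := fun s => ↾(fun x => x.1) }

theorem exists_finset_map_eq [PreservesFilteredColimits G] {X : Type u} (t : G.obj X) :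
    ∃ (s : Finset X) (t' : G.obj {x // x ∈ s}), G.map (↾Subtype.val) t' = t := by
  have hc : IsColimit (finsetCocone X) := isColimitOfDirectedUnion _
    (fun x => ⟨{x}, ⟨x, Finset.mem_singleton_self x⟩, rfl⟩) (fun _ => Subtype.val_injective)
  have hp : PreservesColimitsOfShape (Finset X) G :=
    PreservesFilteredColimitsOfSize.preserves_filtered_colimits _
  obtain ⟨s, y, h⟩ := Types.jointly_surjective_of_isColimit (isColimitOfPreserves G hc) t
  exact ⟨s, y, h⟩

/-- A finitary set functor is a quotient of a polynomial functor. -/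
@[reducible]
noncomputable def qpfOfFinitary [PreservesFilteredColimits G] : QPF.{u, u, u} G.obj where
  map f := G.map (↾f)
  -- By Yoneda, an element of `G n` is a natural family `X ^ n → G X`. Finite supports make these
  -- families jointly cover `G X`.
  P := { A := Σ n : ℕ, G.obj (ULift.{u} (Fin n)), B := fun a => ULift.{u} (Fin a.1) }
  abs := fun p => G.map (↾p.2) p.1.2
  repr := fun {X} t =>
    let s := (exists_finset_map_eq G t).choose
    let t' := (exists_finset_map_eq G t).choose_spec.choose
    ⟨⟨s.card, G.map (↾(fun x => ULift.up (s.equivFin x))) t'⟩,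
      fun i => (s.equivFin.symm i.down).1⟩
  abs_repr := by
    intro X t
    dsimp only
    rw [map_map_apply]
    conv_rhs => rw [← (exists_finset_map_eq G t).choose_spec.choose_spec]
    refine map_congr G (fun x => ?_) _
    simp
  abs_map := by
    rintro X Y f ⟨⟨n, a⟩, g⟩
    change G.map _ a = G.map _ (G.map _ a)
    rw [map_map_apply]
    rfl

/-- A finitary set functor has a final coalgebra. -/
theorem hasTerminal_coalgebra [PreservesFilteredColimits G] :
    HasTerminal (Endofunctor.Coalgebra G) := by
  let _ : QPF.{u, u, u} G.obj := qpfOfFinitary G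
  let Z : Endofunctor.Coalgebra G := ⟨QPF.Cofix G.obj, ↾QPF.Cofix.dest⟩
  refine (IsTerminal.ofUniqueHom (Y := Z)
    (fun X => Endofunctor.Coalgebra.Hom.mk (↾(QPF.Cofix.corec X.str)) ?_) ?_).hasTerminal
  · ext x
    exact (QPF.Cofix.dest_corec (F := G.obj) X.str x).symm
  · suffices h : ∀ (X : Endofunctor.Coalgebra G) (f g : X ⟶ Z), f = g from fun X f => h _ _ _
    intro X f g
    ext x
    -- The pairs of values of two homomorphisms form a bisimulation: after passing to the quotient
    -- by `r`, the two homomorphisms agree, hence so do the transported structures.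
    let r : QPF.Cofix G.obj → QPF.Cofix G.obj → Prop := fun a b => ∃ x, a = f.f x ∧ b = g.f x
    refine QPF.Cofix.bisim_rel r ?_ _ _ ⟨x, rfl, rfl⟩
    rintro _ _ ⟨x, rfl, rfl⟩
    have h1 : G.map f.f (X.str x) = QPF.Cofix.dest (f.f x) := ConcreteCategory.congr_hom f.h x
    have h2 : G.map g.f (X.str x) = QPF.Cofix.dest (g.f x) := ConcreteCategory.congr_hom g.h x
    rw [← h1, ← h2]
    change G.map _ (G.map f.f (X.str x)) = G.map _ (G.map g.f (X.str x))
    rw [map_map_apply, map_map_apply]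
    exact map_congr G (fun x => Quot.sound ⟨x, rfl, rfl⟩) _

end SetFunctors

/-! ### Eilenberg–Moore algebras: images, diagonals and finite generation -/

section Algebras

variable {T : Monad (Type u)}

theorem algHom_apply {A B : T.Algebra} (f : A ⟶ B) (t : T.obj A.A) :
    B.a (T.map f.f t) = f.f (A.a t) :=
  ConcreteCategory.congr_hom f.h t

theorem algComp_apply {A B C : T.Algebra} (f : A ⟶ B) (g : B ⟶ C) (a : A.A) :
    (f ≫ g).f a = g.f (f.f a) := rfl

theorem algHom_ext {A B : T.Algebra} {f g : A ⟶ B} (h : ∀ a, f.f a = g.f a) : f = g := by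
  apply Monad.Algebra.Hom.ext
  ext a
  exact h a

/-- The unit of the monad, as a map into the carrier of the free algebra. -/
def eta (T : Monad (Type u)) {X : Type u} (x : X) : (T.free.obj X).A := T.η.app X x

theorem algHom_ext_eta {X : Type u} {A : T.Algebra} {f g : T.free.obj X ⟶ A}
    (h : ∀ x, f.f (eta T x) = g.f (eta T x)) : f = g := by
  apply hom_ext_eta
  ext x
  exact h x

theorem sharp_eta {X : Type u} {A : T.Algebra} (f : X ⟶ A.A) (x : X) :
    (sharp f).f (eta T x) = f x :=
  ConcreteCategory.congr_hom (eta_sharp f) x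

theorem free_map_eta {X Y : Type u} (f : X ⟶ Y) (x : X) :
    (T.free.map f).f (eta T x) = eta T (f x) :=
  (ConcreteCategory.congr_hom (T.η.naturality f) x).symm

theorem injective_of_mono {A B : T.Algebra} (f : A ⟶ B) [Mono f] : Function.Injective f.f :=
  (mono_iff_injective f.f).1 (inferInstanceAs (Mono (T.forget.map f)))

theorem mono_of_injective {A B : T.Algebra} (f : A ⟶ B) (hf : Function.Injective f.f) :
    Mono f :=
  ⟨fun _ _ h => algHom_ext fun a => hf (ConcreteCategory.congr_hom
    (congrArg Monad.Algebra.Hom.f h) a)⟩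

/-- A map that factorizes a homomorphism through an injective homomorphism is a homomorphism. -/
def algFactor {A B C : T.Algebra} (m : B ⟶ A) (hm : Function.Injective m.f) (f : C ⟶ A)
    (g : C.A ⟶ B.A) (h : ∀ c, m.f (g c) = f.f c) : C ⟶ B where
  f := g
  h := by
    ext t
    apply hm
    change m.f (B.a (T.map g t)) = m.f (g (C.a t))
    rw [← algHom_apply, map_map_apply, h, ← algHom_apply]
    exact congrArg A.a (map_congr T.toFunctor h t)

/-- Pick preimages under `q` and apply `f`. Injectivity of `m` makes the choice irrelevant and
forces the result to be a homomorphism. -/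
theorem exists_diagonal {A B C D : T.Algebra} (q : A ⟶ B) (hq : Function.Surjective q.f)
    (m : C ⟶ D) (hm : Function.Injective m.f) (f : A ⟶ C) (g : B ⟶ D) (h : q ≫ g = f ≫ m) :
    ∃ d : B ⟶ C, q ≫ d = f ∧ d ≫ m = g := by
  have h' : ∀ a, g.f (q.f a) = m.f (f.f a) := fun a =>
    ConcreteCategory.congr_hom (congrArg Monad.Algebra.Hom.f h) a
  let d : B ⟶ C := algFactor m hm g (↾fun b => f.f (Function.surjInv hq b)) (fun b => by
    change m.f (f.f (Function.surjInv hq b)) = g.f b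
    rw [← h', Function.surjInv_eq hq])
  have hd : d ≫ m = g := algHom_ext fun b => by
    change m.f (f.f (Function.surjInv hq b)) = g.f b
    rw [← h', Function.surjInv_eq hq]
  refine ⟨d, algHom_ext fun a => hm ?_, hd⟩
  rw [← h', ← hd]
  rfl

/-- Closure of a subset under the algebra structure. -/
def IsSubalgebra (A : T.Algebra) (p : Set A.A) : Prop :=
  ∀ t : T.obj p, A.a (T.map (↾Subtype.val) t) ∈ p

/-- The subalgebra on a closed subset. -/
def subalgebra (A : T.Algebra) (p : Set A.A) (hp : IsSubalgebra A p) : T.Algebra where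
  A := p
  a := ↾fun t => ⟨_, hp t⟩
  unit := by
    ext x
    have h1 := ConcreteCategory.congr_hom (T.η.naturality (↾(Subtype.val : p → A.A))) x
    have h2 := ConcreteCategory.congr_hom A.unit x.1
    exact (congrArg A.a h1).symm.trans h2
  assoc := by
    ext t
    have h1 := ConcreteCategory.congr_hom (T.μ.naturality (↾(Subtype.val : p → A.A))) t
    have h2 := ConcreteCategory.congr_hom A.assoc (T.map (T.map (↾(Subtype.val : p → A.A))) t)
    change A.a (T.map (↾(Subtype.val : p → A.A)) (T.μ.app _ t)) =
      A.a (T.map (↾(Subtype.val : p → A.A)) (T.map _ t))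
    refine ((congrArg A.a h1).symm.trans h2).trans (congrArg A.a ?_)
    refine (map_map_apply T.toFunctor _ _ _).trans ((map_map_apply T.toFunctor _ _ _).trans ?_).symm
    rfl

/-- The inclusion of a subalgebra. -/
def subalgebraι (A : T.Algebra) (p : Set A.A) (hp : IsSubalgebra A p) :
    subalgebra A p hp ⟶ A where
  f := ↾Subtype.val
  h := rfl

theorem isSubalgebra_range {A B : T.Algebra} (f : A ⟶ B) :
    IsSubalgebra B (Set.range f.f) := by
  intro t
  have hs : Function.Surjective
      (↾(Set.rangeFactorization f.f) : A.A ⟶ (Set.range f.f : Set B.A)) :=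
    Set.rangeFactorization_surjective
  obtain ⟨s, rfl⟩ := map_surjective T.toFunctor hs t
  refine ⟨A.a s, ?_⟩
  rw [← algHom_apply, map_map_apply]
  rfl

/-- The image of a homomorphism. -/
def image {A B : T.Algebra} (f : A ⟶ B) : T.Algebra :=
  subalgebra B (Set.range f.f) (isSubalgebra_range f)

/-- The surjective part of the image factorization. -/
def imageπ {A B : T.Algebra} (f : A ⟶ B) : A ⟶ image f :=
  algFactor (subalgebraι B (Set.range f.f) (isSubalgebra_range f)) Subtype.val_injective f
    (↾fun a => ⟨f.f a, a, rfl⟩) (fun _ => rfl)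

theorem imageπ_surjective {A B : T.Algebra} (f : A ⟶ B) : Function.Surjective (imageπ f).f := by
  rintro ⟨_, a, rfl⟩
  exact ⟨a, rfl⟩

/-- The homomorphism from the free algebra on a finite subset. -/
def finsetHom (A : T.Algebra) (s : Finset A.A) : T.free.obj {x // x ∈ s} ⟶ A :=
  sharp (↾Subtype.val)

theorem finsetHom_range_mono (A : T.Algebra) {s t : Finset A.A} (h : s ≤ t) :
    Set.range (finsetHom A s).f ⊆ Set.range (finsetHom A t).f := by
  rintro _ ⟨x, rfl⟩
  refine ⟨(T.free.map (↾fun y : {x // x ∈ s} => (⟨y.1, h y.2⟩ : {x // x ∈ t}))).f x, ?_⟩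
  have : T.free.map (↾fun y : {x // x ∈ s} => (⟨y.1, h y.2⟩ : {x // x ∈ t})) ≫ finsetHom A t =
      finsetHom A s := algHom_ext_eta fun y => by
    rw [algComp_apply, free_map_eta, finsetHom, finsetHom, sharp_eta, sharp_eta]
    rfl
  rw [← this]
  rfl

/-- The diagram of subalgebras generated by finite subsets. -/
def finsetSubalgebras (A : T.Algebra) : Finset A.A ⥤ T.Algebra where
  obj s := image (finsetHom A s)
  map {s t} f := algFactor (subalgebraι A _ (isSubalgebra_range (finsetHom A t)))
    Subtype.val_injective (subalgebraι A _ (isSubalgebra_range (finsetHom A s)))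
    (↾fun x => ⟨x.1, finsetHom_range_mono A (leOfHom f) x.2⟩) (fun _ => rfl)

/-- An algebra is the directed union of its finitely generated subalgebras. -/
def finsetSubalgebrasCocone (A : T.Algebra) : Cocone (finsetSubalgebras A) where
  pt := A
  ι := { app := fun s => subalgebraι A _ (isSubalgebra_range (finsetHom A s)) }

section Finitary

variable [PreservesFilteredColimits T.toFunctor]

/-- Directed unions are colimits of algebras for a finitary monad. -/
noncomputable def algIsColimitOfDirectedUnion {J : Type u} [PartialOrder J] [IsDirectedOrder J]
    [Nonempty J] {F : J ⥤ T.Algebra} (c : Cocone F)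
    (hsurj : ∀ x : c.pt.A, ∃ i y, (c.ι.app i).f y = x)
    (hinj : ∀ i, Function.Injective (c.ι.app i).f) : IsColimit c :=
  have : PreservesColimitsOfShape J T.toFunctor :=
    PreservesFilteredColimitsOfSize.preserves_filtered_colimits _
  isColimitOfReflects T.forget (isColimitOfDirectedUnion (T.forget.mapCocone c) hsurj hinj)

/-- The forgetful functor preserves this colimit, so elements identified in it are already
identified at a finite stage, by an injective connecting map. -/
theorem ι_injective {J : Type u} [PartialOrder J] [IsDirectedOrder J]
    [Nonempty J] {F : J ⥤ T.Algebra} (hF : ∀ ⦃i j : J⦄ (f : i ⟶ j), Mono (F.map f))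
    {c : Cocone F} (hc : IsColimit c) (i : J) : Function.Injective (c.ι.app i).f := by
  have : PreservesColimitsOfShape J T.toFunctor :=
    PreservesFilteredColimitsOfSize.preserves_filtered_colimits _
  intro x y h
  obtain ⟨j, f, g, h'⟩ := (Types.FilteredColimit.isColimit_eq_iff (F ⋙ T.forget)
    (isColimitOfPreserves T.forget hc)).1 h
  rw [Subsingleton.elim g f] at h'
  have := hF f
  exact injective_of_mono (F.map f) h'

/-- Quotients of free algebras on finite sets are finitely generated. -/
theorem isFinitelyGenerated_of_surjective {X : Type u} [Finite X] {S : T.Algebra}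
    (q : T.free.obj X ⟶ S) (hq : Function.Surjective q.f) : IsFinitelyGenerated S := by
  intro J _ _ _ F hF
  have hp : PreservesColimitsOfShape J T.toFunctor :=
    PreservesFilteredColimitsOfSize.preserves_filtered_colimits _
  refine ⟨fun {c} hc => ⟨Types.FilteredColimit.isColimitOf _ _ ?_ ?_⟩⟩
  · intro f
    change S ⟶ c.pt at f
    have h1 : ∀ x : X, ∃ i y, (c.ι.app i).f y = f.f (q.f (eta T x)) := fun x =>
      Types.jointly_surjective_of_isColimit (isColimitOfPreserves T.forget hc) _
    choose i y h using h1
    -- The finitely many generators all land in one stage `k`. The diagonal then descends the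
    -- induced map from the free algebra to its quotient `S`.
    obtain ⟨k, hk⟩ := Directed.finite_le (r := (· ≤ ·)) directed_id i
    let g : X ⟶ (F.obj k).A := ↾fun x => (F.map (homOfLE (hk x))).f (y x)
    obtain ⟨d, -, hd⟩ := exists_diagonal q hq (c.ι.app k) (ι_injective hF hc k) (sharp g) f
      (algHom_ext_eta fun x => by
        rw [algComp_apply, algComp_apply, sharp_eta, ← h]
        exact (ConcreteCategory.congr_hom (congrArg Monad.Algebra.Hom.f
          (c.w (homOfLE (hk x)))) (y x)).symm)
    exact ⟨k, d, hd.symm⟩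
  · intro i j f g h
    change S ⟶ F.obj i at f
    change S ⟶ F.obj j at g
    change f ≫ c.ι.app i = g ≫ c.ι.app j at h
    obtain ⟨k, hi, hj⟩ := directed_of (· ≤ ·) i j
    refine ⟨k, homOfLE hi, homOfLE hj, ?_⟩
    change f ≫ F.map (homOfLE hi) = g ≫ F.map (homOfLE hj)
    have := mono_of_injective _ (ι_injective hF hc k)
    rw [← cancel_mono (c.ι.app k), Category.assoc, Category.assoc, c.w, c.w, h]

theorem isFinitelyGenerated_free (X : Type u) [Finite X] :
    IsFinitelyGenerated (T.free.obj X) :=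
  isFinitelyGenerated_of_surjective (𝟙 _) (fun x => ⟨x, rfl⟩)

/-- Finitely generated algebras are quotients of free algebras on finite sets. -/
theorem IsFinitelyGenerated.exists_surjective {S : T.Algebra} (hS : IsFinitelyGenerated S) :
    ∃ (X : Type u) (_ : Finite X) (q : T.free.obj X ⟶ S), Function.Surjective q.f := by
  have hinj : ∀ s, Function.Injective ((finsetSubalgebrasCocone S).ι.app s).f := fun s =>
    Subtype.val_injective
  have hc : IsColimit (finsetSubalgebrasCocone S) := algIsColimitOfDirectedUnion _
    (fun x => ⟨{x}, ⟨x, eta T ⟨x, Finset.mem_singleton_self x⟩, sharp_eta _ _⟩, rfl⟩)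
    hinj
  have := hS (Finset S.A) (finsetSubalgebras S) (fun s t f => mono_of_injective _ fun x y h =>
    Subtype.ext (congrArg (fun z => ((show Set.range (finsetHom S t).f from z) : S.A)) h))
  -- The identity of `S` factorizes through one of its finitely generated subalgebras, which is
  -- therefore everything.
  obtain ⟨s, f, hf⟩ := Types.jointly_surjective_of_isColimit
    (isColimitOfPreserves (coyoneda.obj (Opposite.op S)) hc) (𝟙 S)
  refine ⟨{x // x ∈ s}, inferInstance, finsetHom S s, fun x => ?_⟩
  change S ⟶ image (finsetHom S s) at f
  change f ≫ subalgebraι S _ (isSubalgebra_range (finsetHom S s)) = 𝟙 S at hf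
  have h := ConcreteCategory.congr_hom (congrArg Monad.Algebra.Hom.f hf) x
  obtain ⟨t, ht⟩ := (f.f x).2
  exact ⟨t, ht.trans h⟩

end Finitary
end Algebras

/-! ### Coalgebras for the lifting and the adjunction with `H`-coalgebras -/

section Coalgebras

variable {T : Monad (Type u)} {H : Type u ⥤ Type u} {HT : T.Algebra ⥤ T.Algebra}

theorem setCoalgHom_apply {G : Type u ⥤ Type u} {A B : Endofunctor.Coalgebra G} (f : A ⟶ B)
    (a : A.V) : G.map f.f (A.str a) = B.str (f.f a) :=
  ConcreteCategory.congr_hom f.h a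

theorem coalgHom_apply {A B : Endofunctor.Coalgebra HT} (f : A ⟶ B) (a : A.V.A) :
    (HT.map f.f).f (A.str.f a) = B.str.f (f.f.f a) :=
  ConcreteCategory.congr_hom (congrArg Monad.Algebra.Hom.f f.h) a

theorem coalgHom_ext {A B : Endofunctor.Coalgebra HT} {f g : A ⟶ B}
    (h : ∀ a, f.f.f a = g.f.f a) : f = g := by
  apply Endofunctor.Coalgebra.Hom.ext
  exact algHom_ext h

variable (φ : HT ⋙ T.forget ≅ T.forget ⋙ H)

/-- The comparison `U H^T A ⟶ H U A`, as a map. -/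
def phi (A : T.Algebra) (t : (HT.obj A).A) : H.obj A.A := φ.hom.app A t

/-- The inverse comparison `H U A ⟶ U H^T A`, as a map. -/
def phiInv (A : T.Algebra) (t : H.obj A.A) : (HT.obj A).A := φ.inv.app A t

theorem phi_phiInv {A : T.Algebra} (t : H.obj A.A) : phi φ A (phiInv φ A t) = t :=
  ConcreteCategory.congr_hom (φ.inv_hom_id_app A) t

theorem phiInv_phi {A : T.Algebra} (t : (HT.obj A).A) : phiInv φ A (phi φ A t) = t :=
  ConcreteCategory.congr_hom (φ.hom_inv_id_app A) t

theorem phi_map {A B : T.Algebra} (f : A ⟶ B) (t : (HT.obj A).A) :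
    phi φ B ((HT.map f).f t) = H.map f.f (phi φ A t) :=
  ConcreteCategory.congr_hom (φ.hom.naturality f) t

theorem map_phiInv {A B : T.Algebra} (f : A ⟶ B) (t : H.obj A.A) :
    (HT.map f).f (phiInv φ A t) = phiInv φ B (H.map f.f t) :=
  (ConcreteCategory.congr_hom (φ.inv.naturality f) t).symm

theorem phi_injective (A : T.Algebra) : Function.Injective (phi φ A) :=
  Function.LeftInverse.injective (phiInv_phi φ)

theorem lifting_map_injective (φ : HT ⋙ T.forget ≅ T.forget ⋙ H) {A B : T.Algebra} [Nonempty A.A]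
    (f : A ⟶ B)
    (hf : Function.Injective f.f) : Function.Injective (HT.map f).f := by
  intro s t h
  apply phi_injective φ
  apply map_injective H hf
  rw [← phi_map, ← phi_map, h]

theorem determinize_str_eta (X : Endofunctor.Coalgebra (T.toFunctor ⋙ H)) (x : X.V) :
    ((determinize φ).obj X).str.f (eta T x) = phiInv φ (T.free.obj X.V) (X.str x) :=
  sharp_eta _ x

/-- A homomorphism out of a determinized coalgebra, given on generators. -/
def determinizeDesc (X : Endofunctor.Coalgebra (T.toFunctor ⋙ H)) (A : Endofunctor.Coalgebra HT)
    (g : X.V ⟶ A.V.A)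
    (h : ∀ x, phiInv φ A.V (H.map (sharp g).f (X.str x)) = A.str.f (g x)) :
    (determinize φ).obj X ⟶ A where
  f := sharp g
  h := by
    refine algHom_ext_eta fun x => ?_
    refine (congrArg (HT.map (sharp g)).f (determinize_str_eta φ X x)).trans ?_
    refine (map_phiInv φ (sharp g) (X.str x)).trans ((h x).trans ?_)
    exact (congrArg A.str.f (sharp_eta g x)).symm

theorem determinizeDesc_eta (X : Endofunctor.Coalgebra (T.toFunctor ⋙ H))
    (A : Endofunctor.Coalgebra HT) (g : X.V ⟶ A.V.A) (h) (x : X.V) :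
    (determinizeDesc φ X A g h).f.f (eta T x) = g x :=
  sharp_eta g x

variable (T) in
/-- An `H`-coalgebra as an `HT`-coalgebra, via the unit of the monad. -/
def unitCoalg (X : Endofunctor.Coalgebra H) : Endofunctor.Coalgebra (T.toFunctor ⋙ H) where
  V := X.V
  str := X.str ≫ H.map (T.η.app X.V)

/-- The free `H^T`-coalgebra on an `H`-coalgebra. -/
def freeCoalg (X : Endofunctor.Coalgebra H) : Endofunctor.Coalgebra HT :=
  (determinize φ).obj (unitCoalg T X)

theorem freeCoalg_str_eta (X : Endofunctor.Coalgebra H) (x : X.V) :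
    (freeCoalg φ X).str.f (eta T x) =
      phiInv φ (T.free.obj X.V) (H.map (T.η.app X.V) (X.str x)) :=
  determinize_str_eta φ (unitCoalg T X) x

/-- The action of `freeCoalg` on homomorphisms. -/
def freeCoalgMap {X Y : Endofunctor.Coalgebra H} (f : X ⟶ Y) : freeCoalg φ X ⟶ freeCoalg φ Y :=
  (determinize φ).map (X := unitCoalg T X) (Y := unitCoalg T Y)
    { f := f.f
      h := by
        refine comp_aux' X.str Y.str (H.map (T.η.app X.V)) (H.map (T.η.app Y.V)) f.f
          (H.map f.f) (H.map (T.map f.f)) f.h ?_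
        rw [← H.map_comp, ← H.map_comp]
        exact congrArg (fun g => H.map g) (T.η.naturality f.f) }

/-- The unit of the adjunction between `H`-coalgebras and `H^T`-coalgebras. -/
def freeCoalgUnit (X : Endofunctor.Coalgebra H) : X ⟶ (forgetCoalg φ).obj (freeCoalg φ X) where
  f := T.η.app X.V
  h := by
    ext x
    refine Eq.symm ((congrArg (phi φ _) (freeCoalg_str_eta φ X x)).trans ?_)
    exact phi_phiInv φ _

/-- The transpose of a homomorphism of `H`-coalgebras. -/
def freeCoalgDesc {X : Endofunctor.Coalgebra H} {A : Endofunctor.Coalgebra HT}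
    (g : X ⟶ (forgetCoalg φ).obj A) : freeCoalg φ X ⟶ A :=
  determinizeDesc φ (unitCoalg T X) A g.f fun x => by
    apply phi_injective φ
    refine (phi_phiInv φ _).trans ?_
    refine (map_map_apply H (T.η.app X.V) (sharp (A := A.V) g.f).f (X.str x)).trans ?_
    refine Eq.trans ?_ (setCoalgHom_apply g x)
    exact map_congr H (fun x => sharp_eta (A := A.V) g.f x) _

/-- The underlying `H`-coalgebra of a final `H^T`-coalgebra is final. -/
noncomputable def isTerminalForgetCoalg {N : Endofunctor.Coalgebra HT} (hN : IsTerminal N) :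
    IsTerminal ((forgetCoalg φ).obj N) :=
  IsTerminal.ofUniqueHom
    (fun X => freeCoalgUnit φ X ≫ (forgetCoalg φ).map (hN.from (freeCoalg φ X))) (by
      suffices h : ∀ (X : Endofunctor.Coalgebra H) (f g : X ⟶ (forgetCoalg φ).obj N), f = g from
        fun X f => h _ _ _
      intro X f g
      apply Endofunctor.Coalgebra.Hom.ext
      ext x
      -- Transposes into `N` agree by finality, and restricting them to generators recovers the
      -- original homomorphisms.
      have h := hN.hom_ext (freeCoalgDesc φ f) (freeCoalgDesc φ g)
      have hf : (freeCoalgDesc φ f).f.f (eta T x) = f.f x := determinizeDesc_eta _ _ _ _ _ _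
      have hg : (freeCoalgDesc φ g).f.f (eta T x) = g.f x := determinizeDesc_eta _ _ _ _ _ _
      exact hf.symm.trans ((congrArg (fun k : freeCoalg φ X ⟶ N => k.f.f (eta T x)) h).trans hg))

/-- The counit at an `H^T`-coalgebra, underlying which is the algebra structure. -/
theorem freeCoalgDesc_id (A : Endofunctor.Coalgebra HT) :
    (freeCoalgDesc φ (𝟙 ((forgetCoalg φ).obj A))).f.f = A.V.a := by
  change T.map (𝟙 _) ≫ A.V.a = A.V.a
  rw [T.map_id, Category.id_comp]

/-! ### Lifting the final `H`-coalgebra to a final `H^T`-coalgebra -/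

section Lift

variable {Z : Endofunctor.Coalgebra H} (hZ : IsTerminal Z)

/-- The algebra structure on the final `H`-coalgebra, as a coalgebra homomorphism. -/
noncomputable def finalAction : (forgetCoalg φ).obj (freeCoalg φ Z) ⟶ Z := hZ.from _

/-- The final `H`-coalgebra as an algebra for the monad. -/
noncomputable def finalAlgebra : T.Algebra where
  A := Z.V
  a := (finalAction φ hZ).f
  unit := congrArg Endofunctor.Coalgebra.Hom.f
    (hZ.hom_ext (freeCoalgUnit φ Z ≫ finalAction φ hZ) (𝟙 Z))
  assoc := by
    -- The multiplication underlies the counit at the free coalgebra, so both sides of associativity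
    -- are `H`-coalgebra homomorphisms into `Z`.
    have h := congrArg Endofunctor.Coalgebra.Hom.f (hZ.hom_ext
      ((forgetCoalg φ).map (freeCoalgDesc φ (𝟙 ((forgetCoalg φ).obj (freeCoalg φ Z)))) ≫
        finalAction φ hZ)
      ((forgetCoalg φ).map (freeCoalgMap φ (finalAction φ hZ)) ≫ finalAction φ hZ))
    refine Eq.trans ?_ h
    exact congrArg (· ≫ (finalAction φ hZ).f) (freeCoalgDesc_id φ (freeCoalg φ Z)).symm

/-- The algebra structure of the final coalgebra, as an algebra homomorphism. -/
noncomputable def finalAlgebraAction : T.free.obj Z.V ⟶ finalAlgebra φ hZ where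
  f := (finalAction φ hZ).f
  h := (finalAlgebra φ hZ).assoc.symm

/-- The coalgebra structure of the final coalgebra, as an algebra homomorphism. -/
noncomputable def finalStr : finalAlgebra φ hZ ⟶ HT.obj (finalAlgebra φ hZ) where
  f := Z.str ≫ φ.inv.app (finalAlgebra φ hZ)
  h := by
    let s : Z.V ⟶ (HT.obj (finalAlgebra φ hZ)).A := Z.str ≫ φ.inv.app (finalAlgebra φ hZ)
    -- The homomorphism law to prove says that `sharp s` is the action followed by `s`. This
    -- rewrites `sharp s` so that the law becomes the fact that the action is an `H`-coalgebra
    -- homomorphism.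
    have h : (freeCoalg φ Z).str ≫ HT.map (finalAlgebraAction φ hZ) = sharp s := by
      refine algHom_ext_eta fun x => ?_
      refine Eq.trans ?_ (sharp_eta s x).symm
      refine (congrArg (HT.map (finalAlgebraAction φ hZ)).f (freeCoalg_str_eta φ Z x)).trans ?_
      refine (map_phiInv φ _ _).trans (congrArg (phiInv φ _) ?_)
      refine (map_map_apply H _ _ _).trans ?_
      refine (map_congr H (g := 𝟙 _) (fun z => ?_) _).trans
        (ConcreteCategory.congr_hom (H.map_id _) _)
      exact ConcreteCategory.congr_hom (finalAlgebra φ hZ).unit z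
    refine (congrArg Monad.Algebra.Hom.f h).symm.trans ?_
    ext t
    apply phi_injective φ
    refine (phi_map φ (finalAlgebraAction φ hZ) ((freeCoalg φ Z).str.f t)).trans ?_
    refine (setCoalgHom_apply (finalAction φ hZ) t).trans ?_
    exact (phi_phiInv φ (A := finalAlgebra φ hZ) _).symm

/-- The final `H^T`-coalgebra, carried by the final `H`-coalgebra. -/
noncomputable def finalCoalg : Endofunctor.Coalgebra HT where
  V := finalAlgebra φ hZ
  str := finalStr φ hZ

/-- The homomorphism into the final `H^T`-coalgebra. -/
noncomputable def finalFrom (A : Endofunctor.Coalgebra HT) : A ⟶ finalCoalg φ hZ where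
  f :=
    { f := (hZ.from ((forgetCoalg φ).obj A)).f
      h := by
        have h := congrArg Endofunctor.Coalgebra.Hom.f (hZ.hom_ext
          ((forgetCoalg φ).map (freeCoalgMap φ (hZ.from ((forgetCoalg φ).obj A))) ≫
            finalAction φ hZ)
          ((forgetCoalg φ).map (freeCoalgDesc φ (𝟙 ((forgetCoalg φ).obj A))) ≫ hZ.from _))
        refine Eq.trans h ?_
        exact congrArg (· ≫ (hZ.from ((forgetCoalg φ).obj A)).f) (freeCoalgDesc_id φ A) }
  h := by
    refine algHom_ext fun a => ?_
    apply phi_injective φ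
    refine (phi_map φ _ _).trans ?_
    refine (setCoalgHom_apply (hZ.from ((forgetCoalg φ).obj A)) a).trans ?_
    exact (phi_phiInv φ (A := finalAlgebra φ hZ) _).symm

/-- The lifting of a functor with a final coalgebra has a final coalgebra. -/
noncomputable def isTerminalFinalCoalg : IsTerminal (finalCoalg φ hZ) :=
  IsTerminal.ofUniqueHom (finalFrom φ hZ) fun A k => coalgHom_ext fun a => by
    let k' : (forgetCoalg φ).obj A ⟶ Z :=
      { f := k.f.f
        h := by
          ext a
          refine (setCoalgHom_apply ((forgetCoalg φ).map k) a).trans ?_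
          exact phi_phiInv φ (A := finalAlgebra φ hZ) _ }
    exact congrArg (fun k : (forgetCoalg φ).obj A ⟶ Z => k.f a) (hZ.hom_ext k' (hZ.from _))

end Lift

end Coalgebras

/-! ### Subcoalgebras of `H^T`-coalgebras -/

section Subcoalgebras

variable {T : Monad (Type u)} {H : Type u ⥤ Type u} {HT : T.Algebra ⥤ T.Algebra}
variable (φ : HT ⋙ T.forget ≅ T.forget ⋙ H)

/-- An algebra homomorphism that factorizes a coalgebra homomorphism through an injective one is
a coalgebra homomorphism. -/
def coalgFactor (φ : HT ⋙ T.forget ≅ T.forget ⋙ H) {A B C : Endofunctor.Coalgebra HT}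
    (m : B ⟶ A) (hm : Function.Injective m.f.f) (f : C ⟶ A)
    (g : C.V.A ⟶ B.V.A) (h : ∀ c, m.f.f (g c) = f.f.f c) : C ⟶ B where
  f := algFactor m.f hm f.f g h
  h := by
    refine algHom_ext fun c => ?_
    have : Nonempty B.V.A := ⟨g c⟩
    apply lifting_map_injective φ m.f hm
    have h1 : algFactor m.f hm f.f g h ≫ m.f = f.f := algHom_ext h
    refine Eq.trans ?_ (coalgHom_apply m _).symm
    refine Eq.trans ?_ (congrArg A.str.f (h c)).symm
    refine Eq.trans ?_ (coalgHom_apply f c)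
    refine Eq.trans ?_ (congrArg (fun k : C.V ⟶ A.V => (HT.map k).f (C.str.f c)) h1)
    exact congrArg (fun k : HT.obj C.V ⟶ HT.obj A.V => k.f (C.str.f c)) (HT.map_comp _ _).symm

/-- Closure of a subset under the coalgebra structure. -/
def IsSubcoalgebra (A : Endofunctor.Coalgebra HT) (p : Set A.V.A) : Prop :=
  ∀ x ∈ p, ∃ y : H.obj p, H.map (↾Subtype.val) y = phi φ A.V (A.str.f x)

variable {φ}

theorem IsSubcoalgebra.exists_str {A : Endofunctor.Coalgebra HT} {p : Set A.V.A}
    (hp : IsSubalgebra A.V p) (hc : IsSubcoalgebra φ A p) (x : p) :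
    ∃ y : (HT.obj (subalgebra A.V p hp)).A,
      (HT.map (subalgebraι A.V p hp)).f y = A.str.f x.1 := by
  obtain ⟨y, hy⟩ := hc x.1 x.2
  refine ⟨phiInv φ (subalgebra A.V p hp) y, ?_⟩
  refine (map_phiInv φ _ _).trans ?_
  exact (congrArg (phiInv φ A.V) hy).trans (phiInv_phi φ _)

/-- The coalgebra structure on a closed subset. -/
noncomputable def subcoalgebraStr {A : Endofunctor.Coalgebra HT} {p : Set A.V.A}
    (hp : IsSubalgebra A.V p) (hc : IsSubcoalgebra φ A p) :
    subalgebra A.V p hp ⟶ HT.obj (subalgebra A.V p hp) where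
  f := ↾fun x : p => (hc.exists_str hp x).choose
  h := by
    ext t
    -- The chosen lifts are controlled only through the injectivity of `H^T` on the inclusion, which
    -- needs a point; the value of `t` under the structure map is one.
    have : Nonempty (subalgebra A.V p hp).A := ⟨(subalgebra A.V p hp).a t⟩
    apply lifting_map_injective φ (subalgebraι A.V p hp) Subtype.val_injective
    have hs : ∀ x : p, (HT.map (subalgebraι A.V p hp)).f (hc.exists_str hp x).choose =
      (subalgebraι A.V p hp ≫ A.str).f x := fun x => (hc.exists_str hp x).choose_spec
    refine Eq.trans ?_ (hs _).symm
    refine (algHom_apply _ _).symm.trans ?_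
    refine Eq.trans ?_ (algHom_apply (subalgebraι A.V p hp ≫ A.str) t)
    refine congrArg (HT.obj A.V).a ?_
    exact (map_map_apply T.toFunctor _ _ t).trans (map_congr T.toFunctor hs t)

theorem map_subcoalgebraStr {A : Endofunctor.Coalgebra HT} {p : Set A.V.A}
    (hp : IsSubalgebra A.V p) (hc : IsSubcoalgebra φ A p) (x : p) :
    (HT.map (subalgebraι A.V p hp)).f ((subcoalgebraStr hp hc).f x) = A.str.f x.1 :=
  (hc.exists_str hp x).choose_spec

/-- The subcoalgebra on a closed subset. -/
noncomputable def subcoalgebra {A : Endofunctor.Coalgebra HT} {p : Set A.V.A}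
    (hp : IsSubalgebra A.V p) (hc : IsSubcoalgebra φ A p) : Endofunctor.Coalgebra HT where
  V := subalgebra A.V p hp
  str := subcoalgebraStr hp hc

/-- The inclusion of a subcoalgebra. -/
noncomputable def subcoalgebraι {A : Endofunctor.Coalgebra HT} {p : Set A.V.A}
    (hp : IsSubalgebra A.V p) (hc : IsSubcoalgebra φ A p) : subcoalgebra hp hc ⟶ A where
  f := subalgebraι A.V p hp
  h := algHom_ext (map_subcoalgebraStr hp hc)

variable (φ)

theorem isSubcoalgebra_range {A B : Endofunctor.Coalgebra HT} (f : A ⟶ B) :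
    IsSubcoalgebra φ B (Set.range f.f.f) := by
  rintro _ ⟨a, rfl⟩
  refine ⟨H.map (↾Set.rangeFactorization f.f.f) (phi φ A.V (A.str.f a)), ?_⟩
  rw [← coalgHom_apply, phi_map, map_map_apply]
  rfl

end Subcoalgebras

/-! ### The locally finite fixpoint inside the final coalgebra -/

section LocallyFinite

variable {T : Monad (Type u)} {H : Type u ⥤ Type u} {HT : T.Algebra ⥤ T.Algebra}
variable (φ : HT ⋙ T.forget ≅ T.forget ⋙ H)

section Semantics

variable {N : Endofunctor.Coalgebra HT} (hN : IsTerminal N)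

theorem from_apply {A B : Endofunctor.Coalgebra HT} (f : A ⟶ B) (a : A.V.A) :
    (hN.from B).f.f (f.f.f a) = (hN.from A).f.f a := by
  rw [← hN.hom_ext (f ≫ hN.from B) (hN.from A)]
  rfl

/-- The elements of the final coalgebra reached from determinized finite coalgebras. -/
def finiteBehaviours : Set N.V.A :=
  ⋃ X : FinCoalg (T.toFunctor ⋙ H), Set.range (hN.from ((determinize φ).obj X.obj)).f.f

/-- The coproduct of a family of coalgebras. -/
def sigmaCoalg {G : Type u ⥤ Type u} {ι : Type u} (X : ι → Endofunctor.Coalgebra G) :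
    Endofunctor.Coalgebra G where
  V := Σ i, (X i).V
  str := ↾fun x => G.map (↾Sigma.mk x.1) ((X x.1).str x.2)

/-- The coproduct inclusions. -/
def sigmaCoalgι {G : Type u ⥤ Type u} {ι : Type u} (X : ι → Endofunctor.Coalgebra G) (i : ι) :
    X i ⟶ sigmaCoalg X where
  f := ↾(fun x => ⟨i, x⟩ : (X i).V → Σ i, (X i).V)
  h := rfl

/-- A finite coproduct of finite coalgebras is finite, and determinized injections commute with the
maps into `N`. -/
theorem exists_finite_of_forall_mem {ι : Type u} [Finite ι] (g : ι → N.V.A)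
    (hg : ∀ i, g i ∈ finiteBehaviours φ hN) : ∃ X : FinCoalg (T.toFunctor ⋙ H),
      ∀ i, g i ∈ Set.range (hN.from ((determinize φ).obj X.obj)).f.f := by
  simp only [finiteBehaviours, Set.mem_iUnion] at hg
  choose X t ht using hg
  have hX : ∀ i, Finite (X i).obj.V := fun i => (X i).property
  refine ⟨⟨sigmaCoalg fun i => (X i).obj, inferInstanceAs (Finite (Σ i, (X i).obj.V))⟩,
    fun i => ⟨((determinize φ).map (sigmaCoalgι (fun i => (X i).obj) i)).f.f (t i), ?_⟩⟩
  exact (from_apply hN _ _).trans (ht i)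

theorem range_subset_finiteBehaviours (X : FinCoalg (T.toFunctor ⋙ H)) :
    Set.range (hN.from ((determinize φ).obj X.obj)).f.f ⊆ finiteBehaviours φ hN :=
  Set.subset_iUnion_of_subset X subset_rfl

theorem isSubcoalgebra_finiteBehaviours : IsSubcoalgebra φ N (finiteBehaviours φ hN) := by
  intro x hx
  obtain ⟨X, hX⟩ := Set.mem_iUnion.1 hx
  obtain ⟨y, hy⟩ := isSubcoalgebra_range φ _ x hX
  refine ⟨H.map (↾Set.inclusion (range_subset_finiteBehaviours φ hN X)) y, ?_⟩
  rw [← hy, map_map_apply]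
  rfl

/-- Every behaviour of a determinized finite coalgebra is the behaviour of a generator of some
finite coalgebra. -/
theorem exists_generator (X : FinCoalg (T.toFunctor ⋙ H))
    (t : ((determinize φ).obj X.obj).V.A) :
    ∃ (Y : FinCoalg (T.toFunctor ⋙ H)) (y : Y.obj.V),
      (hN.from ((determinize φ).obj Y.obj)).f.f (eta T y) =
        (hN.from ((determinize φ).obj X.obj)).f.f t := by
  -- The new state `none` gets the transition of `t`. The map `g`, sending `none` to `t` and old
  -- states to generators, then extends to a homomorphism back to the determinization of `X`.
  let j : X.obj.V ⟶ Option X.obj.V := ↾some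
  let s : Option X.obj.V → H.obj (T.obj X.obj.V) := fun o =>
    o.elim (phi φ (T.free.obj X.obj.V) (((determinize φ).obj X.obj).str.f t)) X.obj.str
  let Y : Endofunctor.Coalgebra (T.toFunctor ⋙ H) :=
    ⟨Option X.obj.V, ↾fun o => H.map (T.map j) (s o)⟩
  let g : Option X.obj.V ⟶ (T.free.obj X.obj.V).A := ↾fun o => o.elim t (eta T)
  have hX : Finite X.obj.V := X.property
  have hg : T.free.map j ≫ sharp g = 𝟙 _ := algHom_ext_eta fun x =>
    (congrArg (sharp g).f (free_map_eta j x)).trans (sharp_eta g (some x))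
  have hs : ∀ o, phiInv φ (T.free.obj X.obj.V) (s o) =
      ((determinize φ).obj X.obj).str.f (g o) := by
    rintro (_ | x)
    · exact phiInv_phi φ _
    · exact (determinize_str_eta φ X.obj x).symm
  refine ⟨⟨Y, inferInstanceAs (Finite (Option X.obj.V))⟩, (none : Option X.obj.V), ?_⟩
  have h := from_apply hN (determinizeDesc φ Y ((determinize φ).obj X.obj) g fun o => by
    refine Eq.trans (congrArg _ ?_) (hs o)
    refine (map_map_apply H (T.map j) (sharp g).f (s o)).trans ?_
    refine (map_congr H (g := 𝟙 _) (fun z => ?_) _).trans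
      (ConcreteCategory.congr_hom (H.map_id _) _)
    exact ConcreteCategory.congr_hom (congrArg Monad.Algebra.Hom.f hg) z) (eta T (none : Y.V))
  exact h.symm.trans (congrArg _ (determinizeDesc_eta φ Y ((determinize φ).obj X.obj) g _ none))

theorem isLFG_of_isFinitelyGenerated {A : Endofunctor.Coalgebra HT}
    (hA : IsFinitelyGenerated A.V) : IsLFG A :=
  fun _ _ f => ⟨A, 𝟙 A, f, hA, Category.comp_id f⟩

section Finitary

variable [PreservesFilteredColimits T.toFunctor]

/-- A finitary operation involves only finitely many behaviours. All of them lie in one image, which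
is already a subalgebra. -/
theorem isSubalgebra_finiteBehaviours : IsSubalgebra N.V (finiteBehaviours φ hN) := by
  intro t
  obtain ⟨s, t', rfl⟩ := exists_finset_map_eq T.toFunctor t
  obtain ⟨X, hX⟩ := exists_finite_of_forall_mem φ hN (fun x : {x // x ∈ s} => x.1.1)
    (fun x => x.1.2)
  apply range_subset_finiteBehaviours φ hN X
  have h := isSubalgebra_range (hN.from ((determinize φ).obj X.obj)).f
    (T.map (↾fun x => ⟨x.1.1, hX x⟩) t')
  rw [map_map_apply] at h ⊢
  exact h

/-- The locally finite fixpoint, as a subcoalgebra of the final coalgebra. -/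
noncomputable def locallyFiniteFixpoint : Endofunctor.Coalgebra HT :=
  subcoalgebra (isSubalgebra_finiteBehaviours φ hN) (isSubcoalgebra_finiteBehaviours φ hN)

/-- The inclusion of the locally finite fixpoint into the final coalgebra. -/
noncomputable def locallyFiniteFixpointι : locallyFiniteFixpoint φ hN ⟶ N :=
  subcoalgebraι (isSubalgebra_finiteBehaviours φ hN) (isSubcoalgebra_finiteBehaviours φ hN)

theorem locallyFiniteFixpointι_injective :
    Function.Injective (locallyFiniteFixpointι φ hN).f.f :=
  Subtype.val_injective

/-- The required factor is the image in `N` of one determinized finite coalgebra that reaches all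
the finitely many generators of `S`. -/
theorem isLFG_locallyFiniteFixpoint : IsLFG (locallyFiniteFixpoint φ hN) := by
  intro S hS f
  obtain ⟨Y, _, q, hq⟩ := hS.exists_surjective
  obtain ⟨X, hX⟩ := exists_finite_of_forall_mem φ hN
    (fun y => (locallyFiniteFixpointι φ hN).f.f (f.f (q.f (eta T y)))) (fun y => (f.f _).2)
  let k := hN.from ((determinize φ).obj X.obj)
  let P := subcoalgebra (isSubalgebra_range k.f) (isSubcoalgebra_range φ k)
  let i : P ⟶ N := subcoalgebraι (isSubalgebra_range k.f) (isSubcoalgebra_range φ k)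
  let h : P ⟶ locallyFiniteFixpoint φ hN := coalgFactor φ (locallyFiniteFixpointι φ hN)
    (locallyFiniteFixpointι_injective φ hN) i
    (↾Set.inclusion (range_subset_finiteBehaviours φ hN X)) (fun _ => rfl)
  have hfin : Finite X.obj.V := X.property
  let g : Y ⟶ P.V.A := ↾fun y => ⟨_, hX y⟩
  obtain ⟨d, -, hd⟩ := exists_diagonal q hq i.f Subtype.val_injective
    (sharp (A := P.V) g) (f ≫ (locallyFiniteFixpointι φ hN).f)
    (algHom_ext_eta fun y => (congrArg i.f.f (sharp_eta (A := P.V) g y)).symm)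
  refine ⟨P, h, d, isFinitelyGenerated_of_surjective (imageπ k.f) (imageπ_surjective k.f), ?_⟩
  refine algHom_ext fun x => locallyFiniteFixpointι_injective φ hN ?_
  exact ConcreteCategory.congr_hom (congrArg Monad.Algebra.Hom.f hd) x

theorem IsLFG.mem_finiteBehaviours {A : Endofunctor.Coalgebra HT} (hA : IsLFG A) (a : A.V.A) :
    (hN.from A).f.f a ∈ finiteBehaviours φ hN := by
  -- The element `a` is named by a map from the free algebra on one generator, to which the lfg
  -- property applies.
  obtain ⟨P, h, f', hP, hf⟩ := hA (T.free.obj PUnit) (isFinitelyGenerated_free _)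
    (sharp (↾fun _ => a))
  obtain ⟨Y, hY, q, hq⟩ := hP.exists_surjective
  -- Surjections split, so `H q` is surjective. The lifts `x` turn `Y` into a finite `HT`-coalgebra
  -- for which `q` is a coalgebra homomorphism.
  choose x hx using fun y => map_surjective H hq (phi φ P.V (P.str.f (q.f (eta T y))))
  let X : Endofunctor.Coalgebra (T.toFunctor ⋙ H) := ⟨Y, ↾x⟩
  let g : Y ⟶ P.V.A := ↾fun y => q.f (eta T y)
  have hg : sharp g = q := algHom_ext_eta fun y => sharp_eta g y
  let d : (determinize φ).obj X ⟶ P := determinizeDesc φ X P g fun y => by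
    rw [hg]
    exact (congrArg (phiInv φ P.V) (hx y)).trans (phiInv_phi φ _)
  obtain ⟨t, ht⟩ := hq (f'.f (eta T PUnit.unit))
  refine range_subset_finiteBehaviours φ hN ⟨X, hY⟩ ⟨t, ?_⟩
  have h1 : h.f.f (d.f.f t) = a := by
    have hd : d.f.f t = q.f t := congrArg (fun k : T.free.obj Y ⟶ P.V => k.f t) hg
    refine (congrArg h.f.f (hd.trans ht)).trans ?_
    refine Eq.trans ?_ (sharp_eta (↾fun _ => a) PUnit.unit)
    rw [← hf]
    rfl
  rw [← h1, from_apply hN]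
  exact (from_apply hN d t).symm

/-- The homomorphism from an lfg coalgebra to the locally finite fixpoint. -/
noncomputable def IsLFG.toLocallyFiniteFixpoint {A : Endofunctor.Coalgebra HT} (hA : IsLFG A) :
    A ⟶ locallyFiniteFixpoint φ hN :=
  coalgFactor φ (locallyFiniteFixpointι φ hN) (locallyFiniteFixpointι_injective φ hN) (hN.from A)
    (↾fun a => ⟨(hN.from A).f.f a, hA.mem_finiteBehaviours φ hN a⟩) (fun _ => rfl)

/-- The locally finite fixpoint as an lfg coalgebra. -/
noncomputable def locallyFiniteFixpointLFG : CoalgLFG HT :=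
  ⟨locallyFiniteFixpoint φ hN, isLFG_locallyFiniteFixpoint φ hN⟩

/-- The final lfg coalgebra. -/
noncomputable def isTerminalLocallyFiniteFixpoint :
    IsTerminal (locallyFiniteFixpointLFG φ hN) :=
  IsTerminal.ofUniqueHom
    (fun A => ObjectProperty.homMk (A.property.toLocallyFiniteFixpoint φ hN)) fun A f => by
      ext : 1
      refine coalgHom_ext fun a => locallyFiniteFixpointι_injective φ hN ?_
      exact ConcreteCategory.congr_hom (congrArg (fun k : A.obj ⟶ N => k.f.f)
        (hN.hom_ext (f.hom ≫ locallyFiniteFixpointι φ hN) _)) a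

variable {L : CoalgLFG HT} (hL : IsTerminal L)

theorem from_injective (φ : HT ⋙ T.forget ≅ T.forget ⋙ H) (hN : IsTerminal N)
    (hL : IsTerminal L) : Function.Injective (hN.from L.obj).f.f := by
  let e : L ⟶ locallyFiniteFixpointLFG φ hN := (isTerminalLocallyFiniteFixpoint φ hN).from L
  let e' := hL.from (locallyFiniteFixpointLFG φ hN)
  have h : ∀ a, e'.hom.f.f (e.hom.f.f a) = a := fun a =>
    ConcreteCategory.congr_hom (congrArg (fun k : L ⟶ L => k.hom.f.f)
      (hL.hom_ext (e ≫ e') (𝟙 L))) a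
  intro a b hab
  -- By construction, `e` followed by the inclusion is definitionally the map from `L` to `N`.
  have hab' : e.hom.f.f a = e.hom.f.f b := locallyFiniteFixpointι_injective φ hN hab
  rw [← h a, ← h b, hab']

theorem range_from (hL : IsTerminal L) :
    Set.range (hN.from L.obj).f.f = finiteBehaviours φ hN := by
  apply Set.Subset.antisymm
  · rintro _ ⟨a, rfl⟩
    exact L.property.mem_finiteBehaviours φ hN a
  · intro x hx
    let e' := hL.from (locallyFiniteFixpointLFG φ hN)
    let y : (locallyFiniteFixpoint φ hN).V.A := ⟨x, hx⟩
    refine ⟨e'.hom.f.f y, ?_⟩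
    refine (from_apply hN e'.hom y).trans ?_
    exact ConcreteCategory.congr_hom (congrArg (fun k : locallyFiniteFixpoint φ hN ⟶ N => k.f.f)
      (hN.hom_ext _ (locallyFiniteFixpointι φ hN))) y

/-- The homomorphism from a determinized finite coalgebra to the locally finite fixpoint. -/
noncomputable def finDeterminizedTo (X : FinCoalg (T.toFunctor ⋙ H)) :
    (determinize φ).obj X.obj ⟶ L.obj :=
  have : Finite X.obj.V := X.property
  (hL.from ⟨_, isLFG_of_isFinitelyGenerated (isFinitelyGenerated_free X.obj.V)⟩).hom

/-- The locally finite fixpoint as a cocone over the determinized finite coalgebras. -/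
noncomputable def finDeterminizedCocone : Cocone (finDeterminized φ) where
  pt := (forgetCoalg φ).obj L.obj
  ι :=
    { app X := (forgetCoalg φ).map (finDeterminizedTo φ hL X)
      naturality X Y f := by
        have : Finite X.obj.V := X.property
        have : Finite Y.obj.V := Y.property
        refine Eq.trans ?_ (Category.comp_id _).symm
        refine ((forgetCoalg φ).map_comp ((determinize φ).map f.hom) _).symm.trans ?_
        refine congrArg (fun k => (forgetCoalg φ).map k) ?_
        let X' : CoalgLFG HT := ⟨(determinize φ).obj X.obj,
          isLFG_of_isFinitelyGenerated (isFinitelyGenerated_free X.obj.V)⟩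
        let Y' : CoalgLFG HT := ⟨(determinize φ).obj Y.obj,
          isLFG_of_isFinitelyGenerated (isFinitelyGenerated_free Y.obj.V)⟩
        let g : X' ⟶ Y' := ObjectProperty.homMk ((determinize φ).map f.hom)
        exact congrArg (fun k : X' ⟶ L => k.hom) (hL.hom_ext (g ≫ hL.from Y') (hL.from X')) }

theorem exists_finDeterminizedTo_eq (φ : HT ⋙ T.forget ≅ T.forget ⋙ H)
    (hN : IsTerminal N) (hL : IsTerminal L) (a : L.obj.V.A) :
    ∃ X t, (finDeterminizedTo φ hL X).f.f t = a := by
  have h : (hN.from L.obj).f.f a ∈ finiteBehaviours φ hN := L.property.mem_finiteBehaviours φ hN a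
  obtain ⟨X, t, ht⟩ := Set.mem_iUnion.1 h
  refine ⟨X, t, from_injective φ hN hL ?_⟩
  exact (from_apply hN _ _).trans ht

end Finitary
end Semantics
end LocallyFinite

/-! ### Existence of the colimit of determinized finite coalgebras -/

section Colimits

/-- Colimits of coalgebras are formed on carriers. -/
theorem hasColimit_coalgebra {C : Type w} [Category.{v} C] {G : C ⥤ C} {J : Type*} [Category* J]
    (F : J ⥤ Endofunctor.Coalgebra G) [HasColimit (F ⋙ Endofunctor.Coalgebra.forget G)] :
    HasColimit F := by
  let D := F ⋙ Endofunctor.Coalgebra.forget G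
  let e : ∀ j, (F.obj j).V ⟶ colimit D := fun j => colimit.ι D j
  let s : Cocone D :=
    { pt := G.obj (colimit D)
      ι :=
        { app := fun j => (F.obj j).str ≫ G.map (colimit.ι D j)
          naturality := fun i j f => by
            have h : (F.obj i).str ≫ G.map (F.map f).f = (F.map f).f ≫ (F.obj j).str := (F.map f).h
            have h' : (F.map f).f ≫ e j = e i := colimit.w D f
            refine Eq.trans ?_ (Category.comp_id _).symm
            change (F.map f).f ≫ (F.obj j).str ≫ G.map (e j) = (F.obj i).str ≫ G.map (e i)
            rw [← reassoc_of% h, ← G.map_comp, h'] } }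
  let k : colimit D ⟶ G.obj (colimit D) := colimit.desc D s
  have hk : ∀ j, e j ≫ k = (F.obj j).str ≫ G.map (e j) := fun j => colimit.ι_desc s j
  let K : Endofunctor.Coalgebra G := ⟨colimit D, k⟩
  let c : Cocone F :=
    { pt := K
      ι :=
        { app := fun j => Endofunctor.Coalgebra.Hom.mk (e j) (hk j).symm
          naturality := fun i j f => by
            refine Eq.trans ?_ (Category.comp_id _).symm
            apply Endofunctor.Coalgebra.Hom.ext
            exact colimit.w D f } }
  let d : ∀ t : Cocone F, colimit D ⟶ t.pt.V := fun t =>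
    colimit.desc D ((Endofunctor.Coalgebra.forget G).mapCocone t)
  have hfac : ∀ (t : Cocone F) j, e j ≫ d t = (t.ι.app j).f := fun t j => colimit.ι_desc _ j
  refine ⟨⟨c, ⟨fun t => Endofunctor.Coalgebra.Hom.mk (d t) ?_, ?_, ?_⟩⟩⟩
  · refine colimit.hom_ext fun j => ?_
    change e j ≫ k ≫ G.map (d t) = e j ≫ d t ≫ t.pt.str
    rw [reassoc_of% (hk j), reassoc_of% (hfac t j), ← G.map_comp, hfac]
    exact (t.ι.app j).h
  · intro t j
    apply Endofunctor.Coalgebra.Hom.ext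
    exact hfac t j
  · intro t m hm
    apply Endofunctor.Coalgebra.Hom.ext
    refine colimit.hom_ext fun j => ?_
    exact (congrArg Endofunctor.Coalgebra.Hom.f (hm j)).trans (hfac t j).symm

/-- The coalgebras carried by standard finite sets. -/
def standardFinCoalg (G : Type u ⥤ Type u)
    (a : Σ n : ℕ, (ULift.{u} (Fin n) ⟶ G.obj (ULift.{u} (Fin n)))) : FinCoalg G :=
  ⟨⟨ULift.{u} (Fin a.1), a.2⟩, inferInstanceAs (Finite (ULift (Fin a.1)))⟩

/-- Transporting structure along an enumeration puts every finite coalgebra on a standard carrier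
`Fin n`, and such coalgebras form a set. This lets colimits in `Type u` be taken over the large
category of finite coalgebras. -/
theorem essentiallySmall_finCoalg (G : Type u ⥤ Type u) : EssentiallySmall.{u} (FinCoalg G) := by
  let F := inducedFunctor (standardFinCoalg G)
  have : F.EssSurj := ⟨fun X => by
    have hX : Finite X.obj.V := X.property
    obtain ⟨n, ⟨e⟩⟩ := Finite.exists_equiv_fin X.obj.V
    let i : X.obj.V ≅ ULift.{u} (Fin n) := (e.trans Equiv.ulift.symm).toIso
    refine ⟨⟨n, i.inv ≫ X.obj.str ≫ G.map i.hom⟩, ⟨ObjectProperty.isoMk _ ?_⟩⟩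
    refine Endofunctor.Coalgebra.isoMk i.symm ?_
    change (i.inv ≫ X.obj.str ≫ G.map i.hom) ≫ G.map i.inv = i.inv ≫ X.obj.str
    simp [← G.map_comp]⟩
  have : F.IsEquivalence := {}
  exact EssentiallySmall.mk' F.asEquivalence.symm

theorem hasColimit_finCoalg {G G' : Type u ⥤ Type u}
    (F : FinCoalg G ⥤ Endofunctor.Coalgebra G') : HasColimit F :=
  have := essentiallySmall_finCoalg G
  have : HasColimitsOfShape (FinCoalg G) (Type u) :=
    hasColimitsOfShape_of_essentiallySmall.{u} _ _
  hasColimit_coalgebra F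

end Colimits

end LFF

theorem mainTheorem6 (T : Monad (Type u)) (H : Type u ⥤ Type u)
    [PreservesFilteredColimits T.toFunctor] [PreservesFilteredColimits H]
    (HT : T.Algebra ⥤ T.Algebra) (φ : HT ⋙ T.forget ≅ T.forget ⋙ H) :
    -- the final coalgebra, the locally finite fixpoint and the colimit of all determinized
    -- finite coalgebras exist
    HasTerminal (Endofunctor.Coalgebra HT) ∧
    HasTerminal (LFF.CoalgLFG HT) ∧
    HasColimit (LFF.finDeterminized φ) ∧
    -- whichever final coalgebra `N` and locally finite fixpoint `L` are chosen:
    ∀ (N : Endofunctor.Coalgebra HT) (hN : IsTerminal N)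
      (L : LFF.CoalgLFG HT) (_ : IsTerminal L),
      -- `L` is a subcoalgebra of `N`
      Function.Injective (hN.from L.obj).f.f ∧
      -- its image is the union of the images of the determinized finite coalgebras
      Set.range (hN.from L.obj).f.f =
        ⋃ X : LFF.FinCoalg (T.toFunctor ⋙ H), Set.range (LFF.sharpFinal φ hN X.obj) ∧
      Set.range (hN.from L.obj).f.f =
        ⋃ X : LFF.FinCoalg (T.toFunctor ⋙ H), Set.range (LFF.languageSemantics φ hN X.obj) ∧
      -- the final coalgebra for `HT` is carried by the final coalgebra for `H`
      ∃ hU : IsTerminal ((LFF.forgetCoalg φ).obj N),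
        -- `L` is the image of the unique homomorphism from the colimit `K` to it
        ∀ (K : Cocone (LFF.finDeterminized φ)) (_ : IsColimit K),
          Set.range (hU.from K.pt).f = Set.range (hN.from L.obj).f.f ∧
          ∃ w : K.pt ⟶ (LFF.forgetCoalg φ).obj L.obj,
            Function.Surjective w.f ∧
            w ≫ (LFF.forgetCoalg φ).map (hN.from L.obj) = hU.from K.pt := by
  have hZ := LFF.hasTerminal_coalgebra H
  have hT := LFF.isTerminalFinalCoalg φ (terminalIsTerminal (C := Endofunctor.Coalgebra H))
  refine ⟨hT.hasTerminal, (LFF.isTerminalLocallyFiniteFixpoint φ hT).hasTerminal,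
    LFF.hasColimit_finCoalg _, fun N hN L hL => ?_⟩
  have hrange := LFF.range_from φ hN hL
  refine ⟨LFF.from_injective φ hN hL, hrange, hrange.trans ?_,
    LFF.isTerminalForgetCoalg φ hN, fun K hK => ?_⟩
  · apply Set.Subset.antisymm
    · refine Set.iUnion_subset fun X => ?_
      rintro _ ⟨t, rfl⟩
      obtain ⟨Y, y, hy⟩ := LFF.exists_generator φ hN X t
      exact Set.mem_iUnion.2 ⟨Y, y, hy⟩
    · refine Set.iUnion_mono fun X => ?_
      rintro _ ⟨x, rfl⟩
      exact ⟨T.η.app _ x, rfl⟩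
  · let w : K.pt ⟶ (LFF.forgetCoalg φ).obj L.obj := hK.desc (LFF.finDeterminizedCocone φ hL)
    have hw : w ≫ (LFF.forgetCoalg φ).map (hN.from L.obj) =
      (LFF.isTerminalForgetCoalg φ hN).from K.pt := IsTerminal.hom_ext
        (LFF.isTerminalForgetCoalg φ hN) _ _
    -- The cocone legs into `L` are jointly surjective and factorize through `w`.
    have hs : Function.Surjective w.f := fun a => by
      obtain ⟨X, t, ht⟩ := LFF.exists_finDeterminizedTo_eq φ hN hL a
      refine ⟨(K.ι.app X).f t, Eq.trans ?_ ht⟩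
      exact ConcreteCategory.congr_hom (congrArg Endofunctor.Coalgebra.Hom.f
        (hK.fac (LFF.finDeterminizedCocone φ hL) X)) t
    refine ⟨?_, w, hs, hw⟩
    rw [← hw]
    exact Function.Surjective.range_comp hs (hN.from L.obj).f.f
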